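/- **Theorem B.** Let $G=H_3(\mathbb Z)$ be the discrete Heisenberg group, i.e. the set $\mathbb Z^3$ with the multiplication $(x_1,y_1,z_1)(x_2,y_2,z_2)=(x_1+x_2,\;y_1+y_2,\;z_1+z_2+x_1y_2)$, and let $S\subset G$ be any finite generating set. Let $|g|_S$ be the least length of a word in the letters $S\cup S^{-1}$ representing $g$ (when $S$ is symmetric the letters are just the elements of $S$), and let $d_S(x,y)=|x^{-1}y|_S$ be the word metric. Let $C(G)$ be the space of continuous real functions on $(G,d_S)$ with the topology of uniform convergence on compact sets, let $C^0(G)$ be its quotient by the constant functions, with the quotient topology, and let $C^r(G)=C(G)/C_b(G)$ be its quotient by the bounded continuous functions. Let $$\partial(G,S)=\overline{\{[d_S(x,\cdot)]:x\in G\}}\setminus\{[d_S(x,\cdot)]:x\in G\}\subset C^0(G)$$ be the horoboundary, and let the reduced horoboundary $\partial^r(G,S)\subset C^r(G)$ be the image of $\partial(G,S)$ under the natural map $C^0(G)\to C^r(G)$. The group $G$ acts on $\partial^r(G,S)$ through $(g\varphi)(x)=\varphi(g^{-1}x)$. Then this action is trivial: $g\xi=\xi$ for every $g\in G$ and every $\xi\in\partial^r(G,S)$.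 -/

import Mathlib

/-! ### Horoboundaries of metric spaces -/

section Horoboundary

variable (X : Type*) [MetricSpace X]

/-- The one-dimensional subspace of constant functions in `C(X, ℝ)`. -/
def constantMaps : Submodule ℝ C(X, ℝ) := Submodule.span ℝ {(1 : C(X, ℝ))}

/-- The subspace `C_b(X)` of bounded continuous functions in `C(X, ℝ)`. -/
def boundedMaps : Submodule ℝ C(X, ℝ) where
  carrier := {f | ∃ C : ℝ, ∀ x, |f x| ≤ C}
  zero_mem' := ⟨0, fun x => by simp⟩
  add_mem' := by
    rintro f g ⟨C, hC⟩ ⟨D, hD⟩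
    exact ⟨C + D, fun x => (abs_add_le _ _).trans (add_le_add (hC x) (hD x))⟩
  smul_mem' := by
    rintro c f ⟨C, hC⟩
    refine ⟨|c| * C, fun x => ?_⟩
    simpa [abs_mul] using mul_le_mul_of_nonneg_left (hC x) (abs_nonneg c)

theorem constantMaps_le_boundedMaps : constantMaps X ≤ boundedMaps X := by
  rw [constantMaps, Submodule.span_singleton_le_iff_mem]
  exact ⟨1, fun x => by simp⟩

/-- `C⁰(X)`: continuous functions modulo constants. Here `C(X, ℝ)` carries the compact-open
topology, i.e. uniform convergence on compact sets, and the quotient its quotient topology. -/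
abbrev ModConstants : Type _ := C(X, ℝ) ⧸ constantMaps X

/-- `Cʳ(X)`: continuous functions modulo bounded ones. -/
abbrev ModBounded : Type _ := C(X, ℝ) ⧸ boundedMaps X

/-- The natural map `C⁰(X) → Cʳ(X)`. -/
def reduction : ModConstants X →ₗ[ℝ] ModBounded X :=
  Submodule.factor (constantMaps_le_boundedMaps X)

variable {X}

/-- The distance function `d(x, ·)`. -/
def distMap (x : X) : C(X, ℝ) := ⟨fun y => dist x y, by fun_prop⟩

/-- The embedding `X → C⁰(X)`, `x ↦ [d(x, ·)]`. -/
def horoEmbedding (x : X) : ModConstants X := (constantMaps X).mkQ (distMap x)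

variable (X)

/-- The horofunction compactification of `X`. -/
def horocompactification : Set (ModConstants X) := closure (Set.range (horoEmbedding (X := X)))

/-- The horoboundary `∂(X, d)`. -/
def horoboundary : Set (ModConstants X) :=
  horocompactification X \ Set.range (horoEmbedding (X := X))

/-- The reduced horoboundary `∂ʳ(X, d)`: the image of the horoboundary in `Cʳ(X)`. -/
def reducedHoroboundary : Set (ModBounded X) := reduction X '' horoboundary X

end Horoboundary

/-! ### The action of a group of isometries -/

section Action

variable {G X : Type*} [Group G] [MetricSpace X] [MulAction G X] [IsIsometricSMul G X]

/-- Translation of functions: `(g φ)(x) = φ (g⁻¹ x)`. -/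
def translateMap (g : G) : C(X, ℝ) →ₗ[ℝ] C(X, ℝ) where
  toFun φ := ⟨fun x => φ (g⁻¹ • x), φ.continuous.comp (isometry_smul X g⁻¹).continuous⟩
  map_add' _ _ := rfl
  map_smul' _ _ := rfl

@[simp] theorem translateMap_apply (g : G) (φ : C(X, ℝ)) (x : X) :
    translateMap g φ x = φ (g⁻¹ • x) := rfl

theorem translateMap_one (φ : C(X, ℝ)) : translateMap (1 : G) φ = φ := by
  ext x; simp

theorem translateMap_mul (g h : G) (φ : C(X, ℝ)) :
    translateMap (g * h) φ = translateMap g (translateMap h φ) := by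
  ext x; simp [mul_smul]

theorem translateMap_distMap (g : G) (x : X) : translateMap g (distMap x) = distMap (g • x) := by
  ext y
  change dist x (g⁻¹ • y) = dist (g • x) y
  rw [← dist_smul g x (g⁻¹ • y), smul_inv_smul]

theorem continuous_translateMap (g : G) : Continuous (translateMap g : C(X, ℝ) → C(X, ℝ)) :=
  ContinuousMap.continuous_precomp
    (⟨fun x => g⁻¹ • x, (isometry_smul X g⁻¹).continuous⟩ : C(X, X))

theorem constantMaps_le_comap (g : G) :
    constantMaps X ≤ (constantMaps X).comap (translateMap g) := by
  rw [constantMaps, Submodule.span_singleton_le_iff_mem, Submodule.mem_comap]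
  exact Submodule.mem_span_singleton_self _

theorem boundedMaps_le_comap (g : G) :
    boundedMaps X ≤ (boundedMaps X).comap (translateMap g) :=
  fun _ ⟨C, hC⟩ => ⟨C, fun x => hC (g⁻¹ • x)⟩

/-- The map induced on `C⁰(X)` by the translation by `g`. -/
def translateModConstants (g : G) : ModConstants X →ₗ[ℝ] ModConstants X :=
  (constantMaps X).mapQ (constantMaps X) (translateMap g) (constantMaps_le_comap g)

/-- The map induced on `Cʳ(X)` by the translation by `g`. -/
def translateModBounded (g : G) : ModBounded X →ₗ[ℝ] ModBounded X :=
  (boundedMaps X).mapQ (boundedMaps X) (translateMap g) (boundedMaps_le_comap g)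

theorem translateModConstants_horoEmbedding (g : G) (x : X) :
    translateModConstants g (horoEmbedding x) = horoEmbedding (g • x) := by
  simp only [translateModConstants, horoEmbedding, Submodule.mkQ_apply, Submodule.mapQ_apply,
    translateMap_distMap]

theorem translateModConstants_inv (g : G) (η : ModConstants X) :
    translateModConstants g⁻¹ (translateModConstants g η) = η := by
  obtain ⟨φ, rfl⟩ := (constantMaps X).mkQ_surjective η
  simp only [translateModConstants, Submodule.mkQ_apply, Submodule.mapQ_apply, ← translateMap_mul,
    inv_mul_cancel, translateMap_one]

theorem continuous_translateModConstants (g : G) :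
    Continuous (translateModConstants g : ModConstants X → ModConstants X) :=
  ((constantMaps X).isQuotientMap_mkQ.continuous_iff).2
    ((constantMaps X).isQuotientMap_mkQ.continuous.comp (continuous_translateMap g))

theorem translateModConstants_mem (g : G) {η : ModConstants X} (hη : η ∈ horoboundary X) :
    translateModConstants g η ∈ horoboundary X := by
  refine ⟨map_mem_closure (continuous_translateModConstants g) hη.1 ?_, ?_⟩
  · rintro _ ⟨x, rfl⟩
    exact ⟨g • x, (translateModConstants_horoEmbedding g x).symm⟩
  · rintro ⟨x, hx⟩
    refine hη.2 ⟨g⁻¹ • x, ?_⟩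
    rw [← translateModConstants_horoEmbedding, hx, translateModConstants_inv]

theorem translateModBounded_reduction (g : G) (η : ModConstants X) :
    translateModBounded g (reduction X η) = reduction X (translateModConstants g η) := by
  obtain ⟨φ, rfl⟩ := (constantMaps X).mkQ_surjective η
  rfl

theorem translateModBounded_mem (g : G) {ξ : ModBounded X} (hξ : ξ ∈ reducedHoroboundary X) :
    translateModBounded g ξ ∈ reducedHoroboundary X := by
  obtain ⟨η, hη, rfl⟩ := hξ
  exact ⟨translateModConstants g η, translateModConstants_mem g hη,
    (translateModBounded_reduction g η).symm⟩

/-- The action on the reduced horoboundary induced by an isometric action on the space. -/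
instance reducedHoroboundaryAction : MulAction G (reducedHoroboundary X) where
  smul g ξ := ⟨translateModBounded g ξ.1, translateModBounded_mem g ξ.2⟩
  one_smul ξ := by
    apply Subtype.ext
    change translateModBounded (1 : G) ξ.1 = ξ.1
    obtain ⟨φ, hφ⟩ := (boundedMaps X).mkQ_surjective ξ.1
    rw [← hφ]
    simp only [translateModBounded, Submodule.mkQ_apply, Submodule.mapQ_apply, translateMap_one]
  mul_smul g h ξ := by
    apply Subtype.ext
    change translateModBounded (g * h) ξ.1 = translateModBounded g (translateModBounded h ξ.1)
    obtain ⟨φ, hφ⟩ := (boundedMaps X).mkQ_surjective ξ.1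
    rw [← hφ]
    simp only [translateModBounded, Submodule.mkQ_apply, Submodule.mapQ_apply, translateMap_mul]

end Action

/-! ### Word metrics -/

section WordMetric

variable {G : Type*} [Group G]

/-- `l` is a word in the letters `S ∪ S⁻¹` (which is `S` itself when `S` is symmetric). -/
def IsWord (S : Set G) (l : List G) : Prop := ∀ s ∈ l, s ∈ S ∨ s⁻¹ ∈ S

/-- The word norm `|g|_S`: the least length of a word in `S ∪ S⁻¹` that represents `g`. -/
noncomputable def wordNorm (S : Set G) (g : G) : ℕ :=
  sInf {n | ∃ l : List G, IsWord S l ∧ l.prod = g ∧ l.length = n}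

theorem exists_word {S : Set G} (hS : Subgroup.closure S = ⊤) (g : G) :
    ∃ l : List G, IsWord S l ∧ l.prod = g ∧ l.length = wordNorm S g := by
  have hne : {n | ∃ l : List G, IsWord S l ∧ l.prod = g ∧ l.length = n}.Nonempty := by
    have hmem : g ∈ (Subgroup.closure S).toSubmonoid := by simp [hS]
    rw [Subgroup.closure_toSubmonoid] at hmem
    obtain ⟨l, hl, hg⟩ := Submonoid.exists_list_of_mem_closure hmem
    exact ⟨l.length, l, hl, hg, rfl⟩
  exact Nat.sInf_mem hne

theorem wordNorm_le {S : Set G} {l : List G} (hl : IsWord S l) :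
    wordNorm S l.prod ≤ l.length :=
  Nat.sInf_le ⟨l, hl, rfl, rfl⟩

theorem wordNorm_one (S : Set G) : wordNorm S (1 : G) = 0 :=
  Nat.le_zero.1 (wordNorm_le (l := []) (by simp [IsWord]))

theorem wordNorm_inv_le {S : Set G} (hS : Subgroup.closure S = ⊤) (g : G) :
    wordNorm S g⁻¹ ≤ wordNorm S g := by
  obtain ⟨l, hl, rfl, hn⟩ := exists_word hS g
  rw [← hn, List.prod_inv_reverse]
  refine (wordNorm_le ?_).trans (by simp)
  intro s hs
  obtain ⟨t, ht, rfl⟩ := List.mem_map.1 (List.mem_reverse.1 hs)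
  simpa [or_comm] using hl t ht

theorem wordNorm_inv {S : Set G} (hS : Subgroup.closure S = ⊤) (g : G) :
    wordNorm S g⁻¹ = wordNorm S g :=
  le_antisymm (wordNorm_inv_le hS g) (by simpa using wordNorm_inv_le hS g⁻¹)

theorem wordNorm_mul_le {S : Set G} (hS : Subgroup.closure S = ⊤) (g h : G) :
    wordNorm S (g * h) ≤ wordNorm S g + wordNorm S h := by
  obtain ⟨l, hl, hg, hn⟩ := exists_word hS g
  obtain ⟨m, hm, hh, hk⟩ := exists_word hS h
  rw [← hn, ← hk, ← List.length_append, ← hg, ← hh, ← List.prod_append]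
  refine wordNorm_le fun s hs => ?_
  exact (List.mem_append.1 hs).elim (hl s) (hm s)

theorem eq_one_of_wordNorm {S : Set G} (hS : Subgroup.closure S = ⊤) {g : G}
    (h : wordNorm S g = 0) : g = 1 := by
  obtain ⟨l, -, rfl, hn⟩ := exists_word hS g
  rw [h, List.length_eq_zero_iff] at hn
  simp [hn]

/-- The group `G` regarded as a metric space with the word metric of the generating set `S`. -/
def WordMetric (S : Set G) (_hS : Subgroup.closure S = ⊤) : Type _ := G

variable (S : Set G) (hS : Subgroup.closure S = ⊤)

/-- The underlying group element of a point. -/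
def WordMetric.toGroup {S : Set G} {hS : Subgroup.closure S = ⊤} (x : WordMetric S hS) : G := x

/-- The word metric `d_S(x, y) = |x⁻¹ y|_S`. -/
noncomputable instance : MetricSpace (WordMetric S hS) where
  dist x y := (wordNorm S (x.toGroup⁻¹ * y.toGroup) : ℝ)
  dist_self x := by simp [wordNorm_one]
  dist_comm x y := by
    rw [← wordNorm_inv hS (x.toGroup⁻¹ * y.toGroup), mul_inv_rev, inv_inv]
  dist_triangle x y z := by
    have := wordNorm_mul_le hS (x.toGroup⁻¹ * y.toGroup) (y.toGroup⁻¹ * z.toGroup)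
    rw [mul_assoc, mul_inv_cancel_left] at this
    exact_mod_cast this
  eq_of_dist_eq_zero {x y} h :=
    (inv_mul_eq_one (a := x.toGroup) (b := y.toGroup)).1
      (eq_one_of_wordNorm hS (Nat.cast_eq_zero.1 h))

/-- `G` acts on itself by left multiplication. -/
instance : MulAction G (WordMetric S hS) := inferInstanceAs (MulAction G G)

instance : IsIsometricSMul G (WordMetric S hS) where
  isometry_smul g := Isometry.of_dist_eq fun x y => by
    change ((wordNorm S ((g * x.toGroup)⁻¹ * (g * y.toGroup)) : ℕ) : ℝ) =
      (wordNorm S (x.toGroup⁻¹ * y.toGroup) : ℕ)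
    rw [mul_inv_rev, mul_assoc, inv_mul_cancel_left]

end WordMetric

/-! ### The discrete Heisenberg group -/

/-- The discrete Heisenberg group `H₃(ℤ)`: the set `ℤ³` with the multiplication
`(x₁, y₁, z₁) (x₂, y₂, z₂) = (x₁ + x₂, y₁ + y₂, z₁ + z₂ + x₁ y₂)`. -/
@[ext] structure Heisenberg where
  x : ℤ
  y : ℤ
  z : ℤ

namespace Heisenberg

instance : Mul Heisenberg := ⟨fun a b => ⟨a.x + b.x, a.y + b.y, a.z + b.z + a.x * b.y⟩⟩

instance : One Heisenberg := ⟨⟨0, 0, 0⟩⟩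

instance : Inv Heisenberg := ⟨fun a => ⟨-a.x, -a.y, a.x * a.y - a.z⟩⟩

@[simp] theorem mul_x (a b : Heisenberg) : (a * b).x = a.x + b.x := rfl

@[simp] theorem mul_y (a b : Heisenberg) : (a * b).y = a.y + b.y := rfl

@[simp] theorem mul_z (a b : Heisenberg) : (a * b).z = a.z + b.z + a.x * b.y := rfl

@[simp] theorem one_x : (1 : Heisenberg).x = 0 := rfl

@[simp] theorem one_y : (1 : Heisenberg).y = 0 := rfl

@[simp] theorem one_z : (1 : Heisenberg).z = 0 := rfl

@[simp] theorem inv_x (a : Heisenberg) : a⁻¹.x = -a.x := rfl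

@[simp] theorem inv_y (a : Heisenberg) : a⁻¹.y = -a.y := rfl

@[simp] theorem inv_z (a : Heisenberg) : a⁻¹.z = a.x * a.y - a.z := rfl

instance : Group Heisenberg :=
  Group.ofLeftAxioms (fun a b c => by ext <;> simp <;> ring) (fun a => by ext <;> simp)
    (fun a => by ext <;> simp)

end Heisenberg

/-! ### Horofunctions as limits of distance functions to far away points -/

section HorofunctionLimits

variable {X : Type*} [MetricSpace X]

/-! A horofunction `φ` satisfies `φ(g⁻¹y) - φ(y) ≈ |u g⁻¹ y| - |u y|` with `u = x⁻¹` and `x` as far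
away as desired, depending on `y` (`exists_dist_sub_dist_near`). Commutators are central, so `u g⁻¹
y = (u y g⁻¹) z^k`, where `z` generates the centre and `k` depends on `g` and `y`. Right
multiplication by `g⁻¹` costs at most `|g|`. It remains to bound the cost of `z^k` independently of
`k`, once the element it multiplies is far enough from the identity.

This is `exists_wordNorm_mul_center_le`. Split a geodesic word for `w` as `p q`, where the `x`- or
`y`-coordinate of `p` is about `|k|` in absolute value. Conjugating `p` by one step in the other
coordinate direction shifts the central coordinate by about `k`, at bounded cost. If no such prefix
exists, the whole word stays in a strip of width depending on `k`. Its central coordinate then grows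
at most linearly in its length, and distortion of the centre (`exists_wordNorm_center_le`) makes `w`
shorter than a bound depending only on `k`. -/

instance constantMaps_finiteDimensional : FiniteDimensional ℝ (constantMaps X) :=
  inferInstanceAs (FiniteDimensional ℝ (Submodule.span ℝ {(1 : C(X, ℝ))}))

/-- The constants are finite-dimensional, hence closed. The T1 property makes finite sets of
embedded points closed, so that they can be removed when approximating a boundary point. -/
theorem t1Space_modConstants : T1Space (ModConstants X) :=
  have : IsClosed (constantMaps X : Set C(X, ℝ)) := Submodule.closed_of_finiteDimensional _
  have := Submodule.t3_quotient_of_isClosed (constantMaps X)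
  inferInstance

/-- The difference of the values at two points, as a function on `C⁰(X)`. -/
def evalDiff (a b : X) : ModConstants X →ₗ[ℝ] ℝ :=
  (constantMaps X).liftQ
    { toFun := fun f => f a - f b
      map_add' := fun f g => by simp only [ContinuousMap.add_apply]; ring
      map_smul' := fun c f => by
        simp only [ContinuousMap.smul_apply, smul_eq_mul, RingHom.id_apply]; ring }
    (by
      rw [constantMaps, Submodule.span_singleton_le_iff_mem, LinearMap.mem_ker]
      simp)

theorem continuous_evalDiff (a b : X) : Continuous (evalDiff a b : ModConstants X → ℝ) :=
  ((constantMaps X).isQuotientMap_mkQ.continuous_iff).2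
    ((continuous_eval_const a).sub (continuous_eval_const b))

/-- A difference of values of a horofunction is approximated by the distances to a point outside
any given finite set. -/
theorem exists_dist_sub_dist_near {φ : C(X, ℝ)}
    (hφ : (constantMaps X).mkQ φ ∈ horoboundary X) {F : Set X} (hF : F.Finite) (a b : X)
    {ε : ℝ} (hε : 0 < ε) :
    ∃ x ∉ F, |(φ a - φ b) - (dist x a - dist x b)| < ε := by
  have := t1Space_modConstants (X := X)
  -- The closure of the range is the union of the closures of the images of `F` and `Fᶜ`. The first
  -- image is finite, hence closed, and a boundary point is not in the range.
  have hmem : (constantMaps X).mkQ φ ∈ closure (horoEmbedding '' Fᶜ) := by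
    have h := hφ.1
    rw [horocompactification, ← Set.image_univ, ← Set.union_compl_self F, Set.image_union,
      closure_union, (hF.image _).isClosed.closure_eq] at h
    exact h.resolve_left fun h' => hφ.2 (Set.image_subset_range _ _ h')
  have hnear := map_mem_closure (t := evalDiff a b '' (horoEmbedding '' Fᶜ))
    (continuous_evalDiff a b) hmem fun _ => Set.mem_image_of_mem _
  obtain ⟨_, ⟨_, ⟨x, hx, rfl⟩, rfl⟩, hd⟩ := Metric.mem_closure_iff.1 hnear ε hε
  exact ⟨x, hx, hd⟩

end HorofunctionLimits

/-! ### Word norms -/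

section WordNorm

open scoped Pointwise

variable {G : Type*} [Group G] {S : Set G}

/-- Balls are finite, so avoiding a suitable finite set forces points to be arbitrarily far away. -/
theorem finite_wordNorm_le (hfin : S.Finite) (hS : Subgroup.closure S = ⊤) (n : ℕ) :
    {g : G | wordNorm S g ≤ n}.Finite := by
  have hT : {s : G | s ∈ S ∨ s⁻¹ ∈ S}.Finite := hfin.union hfin.inv
  have hword : ∀ l : List G, IsWord S l → l.prod ∈ {s : G | s ∈ S ∨ s⁻¹ ∈ S} ^ l.length := by
    intro l
    induction l with
    | nil => simp
    | cons s l ih =>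
      intro hl
      rw [List.prod_cons, List.length_cons, pow_succ']
      exact Set.mul_mem_mul (hl s (by simp)) (ih fun t ht => hl t (by simp [ht]))
  have hpow : ∀ k : ℕ, ({s : G | s ∈ S ∨ s⁻¹ ∈ S} ^ k).Finite := by
    intro k
    induction k with
    | zero => simp
    | succ k ih => rw [pow_succ]; exact ih.mul hT
  refine ((Set.finite_Iic n).biUnion fun k _ => hpow k).subset fun g hg => ?_
  obtain ⟨l, hl, rfl, hn⟩ := exists_word hS g
  exact Set.mem_biUnion (x := l.length) (by rw [hn]; exact hg) (hword l hl)

/-- The word norm grows at most linearly along a one-parameter subgroup. -/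
theorem wordNorm_zpow_le (hS : Subgroup.closure S = ⊤) (g : G) (n : ℤ) :
    (wordNorm S (g ^ n) : ℤ) ≤ wordNorm S g * |n| := by
  have hnat : ∀ k : ℕ, wordNorm S (g ^ k) ≤ wordNorm S g * k := by
    intro k
    induction k with
    | zero => simp [wordNorm_one]
    | succ k ih =>
      rw [pow_succ, Nat.mul_succ]
      exact (wordNorm_mul_le hS _ _).trans (by omega)
  rcases Int.eq_nat_or_neg n with ⟨k, rfl | rfl⟩
  · simpa using mod_cast hnat k
  · rw [zpow_neg, zpow_natCast, wordNorm_inv hS, abs_neg, Nat.abs_cast]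
    exact_mod_cast hnat k

end WordNorm

/-! ### Word norms in the Heisenberg group -/

namespace Heisenberg

theorem zpow_x_gen (n : ℤ) : (⟨1, 0, 0⟩ : Heisenberg) ^ n = ⟨n, 0, 0⟩ := by
  induction n using Int.induction_on with
  | zero => rfl
  | succ n ih => rw [zpow_add_one, ih]; ext <;> simp
  | pred n ih => rw [zpow_sub_one, ih]; ext <;> simp; ring

theorem zpow_y_gen (n : ℤ) : (⟨0, 1, 0⟩ : Heisenberg) ^ n = ⟨0, n, 0⟩ := by
  induction n using Int.induction_on with
  | zero => rfl
  | succ n ih => rw [zpow_add_one, ih]; ext <;> simp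
  | pred n ih => rw [zpow_sub_one, ih]; ext <;> simp; ring

theorem zpow_z_gen (n : ℤ) : (⟨0, 0, 1⟩ : Heisenberg) ^ n = ⟨0, 0, n⟩ := by
  induction n using Int.induction_on with
  | zero => rfl
  | succ n ih => rw [zpow_add_one, ih]; ext <;> simp
  | pred n ih => rw [zpow_sub_one, ih]; ext <;> simp; ring

variable {S : Set Heisenberg}

/-- Along the three coordinate subgroups the word norm grows at most linearly. -/
theorem exists_wordNorm_coord_le (hS : Subgroup.closure S = ⊤) :
    ∃ K : ℤ, 0 ≤ K ∧ ∀ n : ℤ, (wordNorm S ⟨n, 0, 0⟩ : ℤ) ≤ K * |n| ∧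
      (wordNorm S ⟨0, n, 0⟩ : ℤ) ≤ K * |n| ∧ (wordNorm S ⟨0, 0, n⟩ : ℤ) ≤ K * |n| := by
  refine ⟨wordNorm S ⟨1, 0, 0⟩ + wordNorm S ⟨0, 1, 0⟩ + wordNorm S ⟨0, 0, 1⟩, by positivity,
    fun n => ⟨?_, ?_, ?_⟩⟩
  · rw [← zpow_x_gen]
    exact (wordNorm_zpow_le hS _ n).trans (mul_le_mul_of_nonneg_right (by omega) (abs_nonneg n))
  · rw [← zpow_y_gen]
    exact (wordNorm_zpow_le hS _ n).trans (mul_le_mul_of_nonneg_right (by omega) (abs_nonneg n))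
  · rw [← zpow_z_gen]
    exact (wordNorm_zpow_le hS _ n).trans (mul_le_mul_of_nonneg_right (by omega) (abs_nonneg n))

theorem exists_letter_coord_le (hfin : S.Finite) :
    ∃ M : ℤ, 0 ≤ M ∧ ∀ s : Heisenberg, s ∈ S ∨ s⁻¹ ∈ S → |s.x| ≤ M ∧ |s.y| ≤ M ∧ |s.z| ≤ M := by
  have hT : {s : Heisenberg | s ∈ S ∨ s⁻¹ ∈ S}.Finite := hfin.union hfin.inv
  obtain ⟨M, hM⟩ := (hT.image fun s => |s.x| + |s.y| + |s.z|).bddAbove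
  refine ⟨max M 0, le_max_right _ _, fun s hs => ?_⟩
  have h : |s.x| + |s.y| + |s.z| ≤ M := hM ⟨s, hs, rfl⟩
  have hx := abs_nonneg s.x
  have hy := abs_nonneg s.y
  have hz := abs_nonneg s.z
  have hm := le_max_left M 0
  exact ⟨by linarith, by linarith, by linarith⟩

/-- The distortion of the centre: the word norm of central elements grows at most linearly with
arbitrarily small slope. -/
theorem exists_wordNorm_center_le (hS : Subgroup.closure S = ⊤) (Q : ℤ) (hQ : 0 ≤ Q) :
    ∃ D : ℤ, ∀ m : ℤ, Q * wordNorm S ⟨0, 0, m⟩ ≤ |m| + D := by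
  obtain ⟨K, hK0, hK⟩ := exists_wordNorm_coord_le hS
  -- The commutator of `x^r` and `y^q` is `z^(rq)`, and for fixed `r` its norm is at most about
  -- `2K|q|`, a slope of `2K/r` in `rq`. This `r` makes the slope less than `1/Q`; the square-root
  -- distortion is not needed.
  set r : ℤ := 2 * K * Q + 1 with hr
  have hr0 : 0 < r := by positivity
  refine ⟨Q * (K * r + K * r + K * r + 2 * K), fun m => ?_⟩
  have hdec : (⟨0, 0, m⟩ : Heisenberg) =
      ⟨r, 0, 0⟩ * ⟨0, m / r, 0⟩ * ⟨-r, 0, 0⟩ * ⟨0, -(m / r), 0⟩ * ⟨0, 0, m % r⟩ := by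
    ext <;> simp
    linarith [Int.emod_add_mul_ediv m r]
  have h1 := wordNorm_mul_le hS (⟨r, 0, 0⟩ * ⟨0, m / r, 0⟩ * ⟨-r, 0, 0⟩ * ⟨0, -(m / r), 0⟩)
    ⟨0, 0, m % r⟩
  have h2 := wordNorm_mul_le hS (⟨r, 0, 0⟩ * ⟨0, m / r, 0⟩ * ⟨-r, 0, 0⟩) ⟨0, -(m / r), 0⟩
  have h3 := wordNorm_mul_le hS (⟨r, 0, 0⟩ * ⟨0, m / r, 0⟩) ⟨-r, 0, 0⟩
  have h4 := wordNorm_mul_le hS (⟨r, 0, 0⟩) ⟨0, m / r, 0⟩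
  rw [← hdec] at h1
  have k1 := (hK r).1
  have k2 := (hK (-r)).1
  have k3 := (hK (m / r)).2.1
  have k4 := (hK (-(m / r))).2.1
  have k5 := (hK (m % r)).2.2
  rw [abs_neg] at k2 k4
  rw [abs_of_pos hr0] at k1 k2
  rw [abs_of_nonneg (Int.emod_nonneg m hr0.ne')] at k5
  have k6 : K * (m % r) ≤ K * r := mul_le_mul_of_nonneg_left (Int.emod_lt_of_pos m hr0).le hK0
  have hq : r * |m / r| ≤ |m| + r := by
    have e := Int.emod_add_mul_ediv m r
    have e1 := Int.emod_nonneg m hr0.ne'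
    have e2 := Int.emod_lt_of_pos m hr0
    rw [← abs_of_pos hr0, ← abs_mul, abs_of_pos hr0, show r * (m / r) = m - m % r by linarith]
    calc |m - m % r| ≤ |m| + |m % r| := abs_sub _ _
      _ ≤ |m| + r := by rw [abs_of_nonneg e1]; linarith
  have hN : (wordNorm S ⟨0, 0, m⟩ : ℤ) ≤ K * r + K * r + K * r + 2 * K * |m / r| := by
    have : (wordNorm S ⟨0, 0, m⟩ : ℤ) ≤ wordNorm S ⟨r, 0, 0⟩ + wordNorm S ⟨0, m / r, 0⟩ +
      wordNorm S ⟨-r, 0, 0⟩ + wordNorm S ⟨0, -(m / r), 0⟩ + wordNorm S ⟨0, 0, m % r⟩ := by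
      exact_mod_cast (by omega)
    linarith
  have hq0 := abs_nonneg (m / r)
  -- Since `2KQ = r - 1`, a nonzero quotient gains at least one over `hq`; a zero quotient is
  -- trivial.
  have hq' : 2 * K * Q * |m / r| ≤ |m| + 2 * K * Q := by
    rw [hr] at hq ⊢
    by_cases h0 : |m / (2 * K * Q + 1)| = 0
    · rw [h0, mul_zero]; positivity
    · have : 1 ≤ |m / (2 * K * Q + 1)| := by rw [hr] at hq0; omega
      linarith
  calc Q * (wordNorm S ⟨0, 0, m⟩ : ℤ)
      ≤ Q * (K * r + K * r + K * r + 2 * K * |m / r|) := mul_le_mul_of_nonneg_left hN hQ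
    _ = Q * (K * r + K * r + K * r) + 2 * K * Q * |m / r| := by ring
    _ ≤ Q * (K * r + K * r + K * r) + (|m| + 2 * K * Q) := by linarith
    _ = _ := by ring

/-- A word either has a prefix one of whose first two coordinates has absolute value about `k`,
or both of these coordinates stay below `k`, and then the third one is at most linear in the
length. -/
theorem exists_prefix_or_coord_le {M : ℤ}
    (hM : ∀ s : Heisenberg, s ∈ S ∨ s⁻¹ ∈ S → |s.x| ≤ M ∧ |s.y| ≤ M ∧ |s.z| ≤ M)
    {k : ℤ} (l : List Heisenberg) (hl : IsWord S l) :
    (∃ l₁ l₂, l = l₁ ++ l₂ ∧ ((k ≤ |l₁.prod.x| ∧ |l₁.prod.x| ≤ k + M) ∨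
      (k ≤ |l₁.prod.y| ∧ |l₁.prod.y| ≤ k + M))) ∨
    k ≤ 0 ∨ (|l.prod.x| < k ∧ |l.prod.y| < k ∧ |l.prod.z| ≤ l.length * (M + k * M)) := by
  induction l using List.reverseRecOn with
  | nil =>
    right
    -- For the empty word the strict bounds `0 < k` fail when `k ≤ 0`, hence the separate
    -- alternative.
    by_cases hk : k ≤ 0
    · exact Or.inl hk
    · right; simpa using hk
  | append_singleton l s ih =>
    rcases ih fun t ht => hl t (by simp [ht]) with ⟨l₁, l₂, rfl, h⟩ | hk | ⟨hx, hy, hz⟩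
    · exact Or.inl ⟨l₁, l₂ ++ [s], by simp, h⟩
    · exact Or.inr (Or.inl hk)
    obtain ⟨sx, sy, sz⟩ := hM s (hl s (by simp))
    have hprod : (l ++ [s]).prod = l.prod * s := by simp
    have hx' : |(l.prod * s).x| ≤ |l.prod.x| + |s.x| := abs_add_le _ _
    have hy' : |(l.prod * s).y| ≤ |l.prod.y| + |s.y| := abs_add_le _ _
    -- A coordinate that was below `k` and reaches it with the letter `s` overshoots by at most `M`.
    by_cases h1 : k ≤ |(l.prod * s).x|
    · exact Or.inl ⟨l ++ [s], [], by simp, Or.inl (by rw [hprod]; constructor <;> linarith)⟩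
    by_cases h2 : k ≤ |(l.prod * s).y|
    · exact Or.inl ⟨l ++ [s], [], by simp, Or.inr (by rw [hprod]; constructor <;> linarith)⟩
    refine Or.inr (Or.inr ⟨by rw [hprod]; omega, by rw [hprod]; omega, ?_⟩)
    have hp : |l.prod.x * s.y| ≤ k * M := by
      rw [abs_mul]
      exact mul_le_mul hx.le sy (abs_nonneg _) ((abs_nonneg _).trans hx.le)
    have hz' : |(l.prod * s).z| ≤ |l.prod.z| + |s.z| + |l.prod.x * s.y| :=
      (abs_add_le _ _).trans (by linarith [abs_add_le l.prod.z s.z])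
    rw [hprod, List.length_append, List.length_singleton]
    push_cast
    linarith

/-- Elements of sufficiently large word norm can be multiplied by a given central element at a
cost that does not depend on the central element. -/
theorem exists_wordNorm_mul_center_le (hfin : S.Finite) (hS : Subgroup.closure S = ⊤) :
    ∃ C : ℤ, ∀ k : ℤ, ∃ N : ℕ, ∀ w : Heisenberg, N < wordNorm S w →
      (wordNorm S (w * ⟨0, 0, k⟩) : ℤ) ≤ wordNorm S w + C := by
  obtain ⟨K, hK0, hK⟩ := exists_wordNorm_coord_le hS
  obtain ⟨M, hM0, hM⟩ := exists_letter_coord_le hfin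
  -- The cost of conjugating a prefix by `u` and correcting by a small central element: twice `|u| ≤
  -- K`, plus `K|t|`.
  have hnear : ∀ (p q u w v : Heisenberg) (t : ℤ), v = u * p * u⁻¹ * q * ⟨0, 0, t⟩ →
      (wordNorm S p : ℤ) + wordNorm S q ≤ wordNorm S w → (wordNorm S u : ℤ) ≤ K → |t| ≤ M + 1 →
      (wordNorm S v : ℤ) ≤ wordNorm S w + (2 * K + K * (M + 1)) := by
    rintro p q u w v t rfl hw hu ht
    have h1 := wordNorm_mul_le hS (u * p * u⁻¹ * q) ⟨0, 0, t⟩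
    have h2 := wordNorm_mul_le hS (u * p * u⁻¹) q
    have h3 := wordNorm_mul_le hS (u * p) u⁻¹
    have h4 := wordNorm_mul_le hS u p
    rw [wordNorm_inv hS] at h3
    have h5 := (hK t).2.2.trans (mul_le_mul_of_nonneg_left ht hK0)
    have : (wordNorm S (u * p * u⁻¹ * q * ⟨0, 0, t⟩) : ℤ) ≤ wordNorm S u + wordNorm S p +
      wordNorm S u + wordNorm S q + wordNorm S ⟨0, 0, t⟩ := by exact_mod_cast (by omega)
    linarith
  refine ⟨2 * K + K * (M + 1), fun k => ?_⟩
  -- The added one keeps the threshold positive, which excludes the degenerate alternative below.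
  set j : ℤ := |k| + 1 with hj
  have hj0 : 0 < j := by positivity
  -- One more than the rate `M + jM` at which the central coordinate can grow along a word in the
  -- strip.
  obtain ⟨D, hD⟩ := exists_wordNorm_center_le hS (M + j * M + 1) (by positivity)
  refine ⟨((M + j * M + 1) * (2 * (K * j)) + j * j + D).toNat, fun w hw => ?_⟩
  obtain ⟨l, hl, rfl, hlen⟩ := exists_word hS w
  rcases exists_prefix_or_coord_le hM (k := j) l hl with ⟨l₁, l₂, rfl, hsplit⟩ | hneg | ⟨hx, hy, hz⟩
  · have hpq : (wordNorm S l₁.prod : ℤ) + wordNorm S l₂.prod ≤ wordNorm S (l₁ ++ l₂).prod := by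
      have h1 := wordNorm_le (S := S) (l := l₁) fun s hs => hl s (by simp [hs])
      have h2 := wordNorm_le (S := S) (l := l₂) fun s hs => hl s (by simp [hs])
      rw [← hlen, List.length_append]
      exact_mod_cast add_le_add h1 h2
    -- Choosing `e` so that `e * a` and `k` have opposite signs leaves `|a| - |k|`, which is at most
    -- `M + 1`.
    have hsign : ∀ a : ℤ, j ≤ |a| → |a| ≤ j + M → ∃ e : ℤ, |e| = 1 ∧ |k + e * a| ≤ M + 1 := by
      intro a h1 h2
      rw [hj] at h1 h2
      rcases le_total 0 a with ha | ha <;> rcases le_total 0 k with hk | hk <;>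
        simp only [abs_of_nonneg, abs_of_nonpos, ha, hk] at h1 h2
      · exact ⟨-1, rfl, abs_le.2 ⟨by linarith, by linarith⟩⟩
      · exact ⟨1, rfl, abs_le.2 ⟨by linarith, by linarith⟩⟩
      · exact ⟨1, rfl, abs_le.2 ⟨by linarith, by linarith⟩⟩
      · exact ⟨-1, rfl, abs_le.2 ⟨by linarith, by linarith⟩⟩
    rcases hsplit with ⟨h1, h2⟩ | ⟨h1, h2⟩
    · obtain ⟨e, he, het⟩ := hsign _ h1 h2
      -- This conjugation lowers the central coordinate of the prefix by `e * l₁.prod.x`; the factor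
      -- at the end restores it and adds `k`.
      refine hnear l₁.prod l₂.prod ⟨0, e, 0⟩ _ _ (k + e * l₁.prod.x) ?_ hpq ?_ het
      · rw [List.prod_append]
        ext <;> simp
        ring
      · simpa [he] using (hK e).2.1
    · obtain ⟨e, he, het⟩ := hsign _ h1 h2
      refine hnear l₁.prod l₂.prod ⟨-e, 0, 0⟩ _ _ (k + e * l₁.prod.y) ?_ hpq ?_ het
      · rw [List.prod_append]
        ext <;> simp
        ring
      · simpa [he] using (hK (-e)).1
  · omega
  · exfalso
    set w := l.prod with hwdef
    have hdec : w = ⟨w.x, 0, 0⟩ * ⟨0, w.y, 0⟩ * ⟨0, 0, w.z - w.x * w.y⟩ := by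
      ext <;> simp
    have h1 := wordNorm_mul_le hS (⟨w.x, 0, 0⟩ * ⟨0, w.y, 0⟩) ⟨0, 0, w.z - w.x * w.y⟩
    have h2 := wordNorm_mul_le hS ⟨w.x, 0, 0⟩ ⟨0, w.y, 0⟩
    rw [← hdec] at h1
    have k1 := (hK w.x).1.trans (mul_le_mul_of_nonneg_left hx.le hK0)
    have k2 := (hK w.y).2.1.trans (mul_le_mul_of_nonneg_left hy.le hK0)
    have k3 := hD (w.z - w.x * w.y)
    have k4 : |w.z - w.x * w.y| ≤ wordNorm S w * (M + j * M) + j * j := by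
      refine (abs_sub _ _).trans (add_le_add (by rwa [← hlen]) ?_)
      rw [abs_mul]
      exact mul_le_mul hx.le hy.le (abs_nonneg _) hj0.le
    have h3 : (wordNorm S w : ℤ) ≤ 2 * (K * j) + wordNorm S ⟨0, 0, w.z - w.x * w.y⟩ := by
      have : (wordNorm S w : ℤ) ≤ wordNorm S ⟨w.x, 0, 0⟩ + wordNorm S ⟨0, w.y, 0⟩ +
        wordNorm S ⟨0, 0, w.z - w.x * w.y⟩ := by exact_mod_cast (by omega)
      linarith
    -- Now `(M + jM + 1)|w|` is at most `(M + jM)|w|` plus a constant, so `|w|` is at most that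
    -- constant, contrary to `hw`.
    have h4 := mul_le_mul_of_nonneg_left h3 (show 0 ≤ M + j * M + 1 by positivity)
    have h5 : (wordNorm S w : ℤ) ≤ (M + j * M + 1) * (2 * (K * j)) + j * j + D := by linarith
    have h6 := Int.toNat_le_toNat h5
    rw [Int.toNat_natCast] at h6
    omega

end Heisenberg

/-! ### Triviality of the action -/

theorem theoremB (S : Set Heisenberg) (hfin : S.Finite) (hgen : Subgroup.closure S = ⊤)
    (g : Heisenberg) (ξ : reducedHoroboundary (WordMetric S hgen)) : g • ξ = ξ := by
  obtain ⟨_, η, hη, rfl⟩ := ξ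
  obtain ⟨φ, rfl⟩ := (constantMaps _).mkQ_surjective η
  apply Subtype.ext
  change (boundedMaps (WordMetric S hgen)).mkQ (translateMap g φ) = (boundedMaps _).mkQ φ
  rw [Submodule.mkQ_apply, Submodule.mkQ_apply, Submodule.Quotient.eq]
  obtain ⟨C, hC⟩ := Heisenberg.exists_wordNorm_mul_center_le hfin hgen
  -- The summands account for the central factor, for right multiplication by `g` or its inverse,
  -- and for the approximation error.
  refine ⟨C + wordNorm S g + 1, fun y => ?_⟩
  change |φ (g⁻¹ • y) - φ y| ≤ _
  obtain ⟨k, hk⟩ : ∃ k : ℤ, y.toGroup⁻¹ * g⁻¹ * y.toGroup = g⁻¹ * ⟨0, 0, k⟩ := by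
    refine ⟨(g * (y.toGroup⁻¹ * g⁻¹ * y.toGroup)).z, ?_⟩
    ext <;> simp
    ring
  obtain ⟨N₁, hN₁⟩ := hC k
  obtain ⟨N₂, hN₂⟩ := hC (-k)
  set h : Heisenberg := y.toGroup with hh
  have hF : ∀ (v : Heisenberg) (n : ℕ),
      {x : WordMetric S hgen | wordNorm S (x.toGroup⁻¹ * v) ≤ n}.Finite := fun v n =>
    (finite_wordNorm_le hfin hgen n).preimage (f := fun x : Heisenberg => x⁻¹ * v)
      fun a _ b _ hab => inv_injective (mul_right_cancel hab)
  -- The thresholds `N₁`, `N₂` depend on `y` through `k`, but `x` is chosen after `y`. Both sets are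
  -- avoided because the central lemma is applied twice: with `k` at `u h g⁻¹` and with `-k` at `u
  -- g⁻¹ h`.
  obtain ⟨x, hx, hd⟩ := exists_dist_sub_dist_near hη
    ((hF (h * g⁻¹) N₁).union (hF (g⁻¹ * h) N₂)) (g⁻¹ • y) y one_pos
  rw [Set.mem_union, not_or, Set.mem_ofPred_eq, Set.mem_ofPred_eq, not_le, not_le] at hx
  set u : Heisenberg := x.toGroup⁻¹ with hu
  change |φ (g⁻¹ • y) - φ y - ((wordNorm S (u * (g⁻¹ * h)) : ℝ) - wordNorm S (u * h))| < 1 at hd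
  have h1 := hN₁ _ hx.1
  have h2 := hN₂ _ hx.2
  have e1 : u * (h * g⁻¹) * ⟨0, 0, k⟩ = u * (g⁻¹ * h) := by
    rw [mul_assoc u, mul_assoc h, ← hk]; group
  have e2 : u * (g⁻¹ * h) * ⟨0, 0, -k⟩ = u * (h * g⁻¹) := by
    rw [← e1, mul_assoc]
    convert mul_one _
    ext <;> simp
  rw [e1] at h1
  rw [e2] at h2
  have h3 := wordNorm_mul_le hgen (u * h) g⁻¹
  have h4 := wordNorm_mul_le hgen (u * (h * g⁻¹)) g
  rw [wordNorm_inv hgen, mul_assoc] at h3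
  rw [mul_assoc u, inv_mul_cancel_right] at h4
  have h5 : (wordNorm S (u * (g⁻¹ * h)) : ℝ) ≤ wordNorm S (u * h) + C + wordNorm S g := by
    exact_mod_cast (by omega : (wordNorm S (u * (g⁻¹ * h)) : ℤ) ≤
      wordNorm S (u * h) + C + wordNorm S g)
  have h6 : (wordNorm S (u * h) : ℝ) ≤ wordNorm S (u * (g⁻¹ * h)) + C + wordNorm S g := by
    exact_mod_cast (by omega : (wordNorm S (u * h) : ℤ) ≤
      wordNorm S (u * (g⁻¹ * h)) + C + wordNorm S g)
  rw [abs_lt] at hd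
  exact abs_le.2 ⟨by linarith, by linarith⟩
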